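/- **Setting.** Let $R$ be a countable principal ideal domain which is not a field, let $A$ be an (associative, unital) $R$-algebra that is free as an $R$-module, let $\lambda$ be a cardinal with $|A|<\lambda\le 2^{\aleph_0}$, and put $\kappa=|A|^{+}+\aleph_1$. Enumerate $R\setminus\{0\}=\{s_n:n\in\omega\}$ and put $q_0=1$, $q_{n+1}=s_nq_n^2$. *Trees.* A finite branch is a map $n\to 2$, $n<\omega$, and an infinite branch is a map $\omega\to2$; for distinct infinite branches $v,w$ let $br(v,w)=\min\{n: v(n)\ne w(n)\}$. Let $(C_\alpha)_{\alpha<\lambda}$ be infinite, pairwise almost disjoint subsets of $\omega$. For each $\alpha<\lambda$ let $T'_\alpha$ be a set of finite branches, closed under initial segments, all of whose members vanish outside $C_\alpha$ (for instance all such finite branches, or a perfect subtree of these), and put $T_\alpha=T'_\alpha\times\{\alpha\}$. Let $V_\alpha$ ($\alpha<\lambda$) be pairwise disjoint sets of infinite branches with $|V_\alpha|=\kappa$ and $v\restriction n\in T'_\alpha$ for all $v\in V_\alpha$, $n\in\omega$. *Module.* Let $B=\bigoplus_{\tau\in\bigcup_\alpha T_\alpha}A\tau$ be the free left $A$-module on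 the disjoint union of the trees, and let $\widehat B=\varprojlim_n B/q_nB\supseteq B$ be its $R$-adic completion. For $v\in V_\alpha$, $n\in\omega$, $g\in\widehat B$ put $$y_{vng}=\sum_{i\ge n}\frac{q_i}{q_n}\,(v\restriction i,\alpha)+\Big(\sum_{i\ge n}\frac{q_i}{q_n}v(i)\Big)g\in\widehat B .$$ For $b\in B$ let $\|b\|$ be the least $\beta<\lambda$ such that the support of $b$ is contained in $\bigcup_{\alpha<\beta}T_\alpha$ ($\|b\|=\infty$ if there is none). Let $(b_\alpha)_{\alpha<\lambda}$ be a sequence that runs $\lambda$ times through the non-zero elements $b\in B$ with $B/Ab$ a free $A$-module. Define $A$-submodules $G_\beta\subseteq\widehat B$ ($\beta\le\lambda$) by $G_0=0$, $G_\delta=\bigcup_{\gamma<\delta}G_\gamma$ for limit ordinals $\delta\le\lambda$, and, for $\alpha<\lambda$, $$G_{\alpha+1}=\big\langle G_\alpha\cup T_\alpha\cup\{y_{vng_\alpha}:v\in V_\alpha,\ n\in\omega\}\big\rangle_A ,$$ where $g_\alpha=b_\alpha$ if $b_\alpha\in G_\alpha$ and $\|b_\alpha\|\le\alpha$, and $g_\alpha=0$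 otherwise. Let $G=\bigcup_{\alpha<\lambda}G_\alpha$. **Claim.** Let $\alpha<\lambda$, $\beta\le\lambda$, $m\in\omega$, and let $T\subseteq V_\alpha$ with $|T|=\kappa$ be such that $br(v,w)\ge m$ for all distinct $v,w\in T$. Let $z\in G\setminus q_mG$ and let $\{t_v\in G_\beta:v\in T\}$ be a family of rigid tree-elements for $z$, that is: for all distinct $v,w\in T$, with $n=br(v,w)$, at least one of $t_v-t_w+q_nz$ and $t_v-t_w-q_nz$ belongs to $q_{n+1}G$ (the sign may depend on the pair). Then $z\in Ag_\alpha$. -/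

import Mathlib

open Cardinal

universe u v w

noncomputable section

namespace RigidTree

/-! ### The divisor chain and the `R`-adic completion -/

/-- `q 0 = 1` and `q (n + 1) = s n * (q n) ^ 2`. -/
def q {R : Type u} [CommRing R] (s : ℕ → R) : ℕ → R
  | 0 => 1
  | n + 1 => s n * q s n ^ 2

/-- The quotient `q (n + j) / q n`, computed as the product of the factors
`q (i + 1) / q i = s i * q i` for `n ≤ i < n + j`. -/
def qRatio {R : Type u} [CommRing R] (s : ℕ → R) (n : ℕ) : ℕ → R
  | 0 => 1
  | j + 1 => s (n + j) * q s (n + j) * qRatio s n j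

theorem q_add {R : Type u} [CommRing R] (s : ℕ → R) (n j : ℕ) :
    q s (n + j) = qRatio s n j * q s n := by
  induction j with
  | zero => simp [qRatio]
  | succ j ih =>
    have h : q s (n + (j + 1)) = s (n + j) * q s (n + j) ^ 2 := rfl
    rw [h, qRatio, mul_assoc, ← ih]
    ring

theorem q_dvd_qRatio {R : Type u} [CommRing R] (s : ℕ → R) (n k : ℕ) :
    q s k ∣ qRatio s n (k + 1) := by
  have h1 : q s k ∣ q s (n + k) := by
    rw [Nat.add_comm, q_add]
    exact Dvd.intro_left _ rfl
  exact h1.trans ⟨s (n + k) * qRatio s n k, by rw [qRatio]; ring⟩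

section Completion

variable {R : Type u} [CommRing R] (A : Type v) [Ring A] [Algebra R A] (s : ℕ → R)
  (M : Type w) [AddCommGroup M] [Module R M] [Module A M] [IsScalarTower R A M]

/-- The `A`-submodule `q n M` of `M`. -/
def qSub (n : ℕ) : Submodule A M where
  carrier := {x | ∃ y : M, x = q s n • y}
  zero_mem' := ⟨0, by simp⟩
  add_mem' := by
    rintro _ _ ⟨x, rfl⟩ ⟨y, rfl⟩
    exact ⟨x + y, by simp⟩
  smul_mem' := by
    rintro a _ ⟨x, rfl⟩
    exact ⟨a • x, by rw [smul_algebra_smul_comm]⟩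

theorem qSub_succ_le (n : ℕ) : qSub A s M (n + 1) ≤ qSub A s M n := by
  rintro _ ⟨y, rfl⟩
  exact ⟨(s n * q s n) • y, by rw [smul_smul, q]; congr 1; ring⟩

/-- The completion of `M` in the `R`-topology, whose basic neighbourhoods of `0` are the
submodules `q n M`: the inverse limit of the quotients `M / q n M`. -/
def Completion : Submodule A (∀ n, M ⧸ qSub A s M n) where
  carrier := {f | ∀ n, Submodule.factor (qSub_succ_le A s M n) (f (n + 1)) = f n}
  zero_mem' := fun n => by simp
  add_mem' := fun {f g} hf hg n => by simp [hf n, hg n]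
  smul_mem' := fun a f hf n => by simp [hf n]

/-- The canonical map of `M` into its completion. -/
def toCompletion : M →ₗ[A] Completion A s M where
  toFun x := ⟨fun _ => Submodule.Quotient.mk x, fun _ => rfl⟩
  map_add' _ _ := rfl
  map_smul' _ _ := rfl

variable {M}

/-- The sum `∑_{i ≥ n} (q i / q n) x (i - n)` in the completion. Modulo `q k` only the first
`k + 1` summands count. -/
def series (n : ℕ) (x : ℕ → Completion A s M) : Completion A s M :=
  ⟨fun k => (∑ j ∈ Finset.range (k + 1), qRatio s n j • x j).1 k, fun k => by
    have hk := (∑ j ∈ Finset.range (k + 1 + 1), qRatio s n j • x j).2 k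
    rw [hk, Finset.sum_range_succ]
    have h0 : (qRatio s n (k + 1) • x (k + 1)).1 k = 0 := by
      obtain ⟨c, hc⟩ := q_dvd_qRatio s n k
      obtain ⟨y, hy⟩ := Submodule.Quotient.mk_surjective _ ((x (k + 1)).1 k)
      change qRatio s n (k + 1) • (x (k + 1)).1 k = 0
      rw [← hy, ← Submodule.Quotient.mk_smul, Submodule.Quotient.mk_eq_zero]
      exact ⟨c • y, by rw [hc, mul_smul]⟩
    change (∑ j ∈ Finset.range (k + 1), qRatio s n j • x j).1 k
      + (qRatio s n (k + 1) • x (k + 1)).1 k = _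
    rw [h0, add_zero]⟩

end Completion

/-! ### Trees and forests -/

/-- The finite branch `v ↾ n`; finite branches are lists of zeros and ones. -/
def restr (v : ℕ → Bool) (n : ℕ) : List Bool := (List.range n).map v

/-- The branch point of two infinite branches. -/
def br (v w : ℕ → Bool) : ℕ := sInf {n | v n ≠ w n}

/-- The tree of all finite branches that vanish outside `C`. -/
def treeOf (C : Set ℕ) : Set (List Bool) :=
  {τ | ∀ (e : ℕ) (h : e < τ.length), e ∉ C → τ[e] = false}

/-- A forest of `lam` trees, the `α`-th one being a subtree of `treeOf (C α)` (for instance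
`treeOf (C α)` itself, or a perfect subtree of it), with a set `V α` of `kap` infinite branches
of each tree. -/
structure Forest (kap lam : Cardinal.{v}) where
  C : Set.Iio lam.ord → Set ℕ
  C_infinite : ∀ α, (C α).Infinite
  C_almostDisjoint : ∀ α β, α ≠ β → (C α ∩ C β).Finite
  tree : Set.Iio lam.ord → Set (List Bool)
  tree_subset : ∀ α, tree α ⊆ treeOf (C α)
  tree_prefix : ∀ α, ∀ τ ∈ tree α, ∀ σ, σ <+: τ → σ ∈ tree α
  V : Set.Iio lam.ord → Set (ℕ → Bool)
  V_branch : ∀ α, ∀ v ∈ V α, ∀ n, restr v n ∈ tree α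
  V_disjoint : ∀ α β, α ≠ β → Disjoint (V α) (V β)
  V_card : ∀ α, Cardinal.lift.{v} #(V α) = kap

section Construction

variable {kap lam : Cardinal.{v}} (F : Forest kap lam)

/-- The nodes of the forest: the disjoint union of the trees. -/
def Forest.Node : Type (v + 1) := Σ α : Set.Iio lam.ord, F.tree α

/-- The norm of a set of nodes: the least `β < lam` such that all nodes lie in the trees with
index below `β`, and `⊤` if there is none. -/
def Forest.norm (X : Set F.Node) : WithTop Ordinal.{v} :=
  sInf ((fun β : Ordinal.{v} => (β : WithTop Ordinal.{v})) ''
    {β | β < lam.ord ∧ ∀ τ ∈ X, (τ.1 : Ordinal.{v}) < β})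

variable {R : Type u} [CommRing R] (A : Type v) [Ring A] [Algebra R A] (s : ℕ → R)

/-- The base module: the free `A`-module on the nodes. -/
abbrev Base : Type (v + 1) := F.Node →₀ A

/-- The completion of the base module. -/
abbrev Hat : Type (v + 1) := Completion A s (Base F A)

/-- The inclusion of the base module into its completion. -/
abbrev emb : Base F A →ₗ[A] Hat F A s := toCompletion A s (Base F A)

/-- The branch element
`y_{vng} = ∑_{i ≥ n} (q i / q n) (v ↾ i, α) + g ∑_{i ≥ n} (q i / q n) v(i)`. -/
def branchElt (α : Set.Iio lam.ord) (v : F.V α) (n : ℕ) (g : Hat F A s) : Hat F A s :=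
  series A s n fun j =>
    emb F A s (Finsupp.single ⟨α, restr v.1 (n + j), F.V_branch α v.1 v.2 (n + j)⟩ 1)
      + if v.1 (n + j) then g else 0

variable {A}

open Classical in
/-- The element `g_α`, given the submodule `N = G_α`. -/
def pick (b : Set.Iio lam.ord → Base F A) (α : Set.Iio lam.ord)
    (N : Submodule A (Hat F A s)) : Base F A :=
  if emb F A s (b α) ∈ N ∧ F.norm ((b α).support : Set F.Node) ≤ ((α : Ordinal.{v}) : WithTop _)
  then b α else 0

open Classical in
/-- The chain `G_β`, continued constantly from `lam` on. -/
def chain (b : Set.Iio lam.ord → Base F A) (β : Ordinal.{v}) : Submodule A (Hat F A s) :=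
  Ordinal.limitRecOn (motive := fun _ => Submodule A (Hat F A s)) β
    ⊥
    (fun α N =>
      if h : α ∈ Set.Iio lam.ord then
        Submodule.span A
          ((N : Set (Hat F A s))
            ∪ {x | ∃ τ : F.tree ⟨α, h⟩, x = emb F A s (Finsupp.single ⟨⟨α, h⟩, τ⟩ 1)}
            ∪ {x | ∃ (v : F.V ⟨α, h⟩) (n : ℕ),
                x = branchElt F A s ⟨α, h⟩ v n (emb F A s (pick F s b ⟨α, h⟩ N))})
      else N)
    (fun δ _ N => ⨆ γ : Set.Iio δ, N γ.1 (Set.mem_Iio.1 γ.2))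

/-- The element `g_α`. -/
def gElt (b : Set.Iio lam.ord → Base F A) (α : Set.Iio lam.ord) : Base F A :=
  pick F s b α (chain F s b α)

/-- The constructed module `G = ⋃_{α < lam} G_α`. -/
def G (b : Set.Iio lam.ord → Base F A) : Submodule A (Hat F A s) :=
  ⨆ α : Set.Iio lam.ord, chain F s b α

/-- The sequence `b` runs `lam` times through the non-zero elements `x` of the base module with
free quotient modulo `A x`. -/
def IsEnumeration (b : Set.Iio lam.ord → Base F A) : Prop :=
  (∀ α, b α ≠ 0 ∧ Module.Free A (Base F A ⧸ Submodule.span A {b α})) ∧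
  ∀ x : Base F A, x ≠ 0 → Module.Free A (Base F A ⧸ Submodule.span A {x}) →
    #{α // b α = x} = Cardinal.lift.{v + 1} lam

/-- A family `t_v ∈ G_β` (`v ∈ T`) of rigid tree-elements for `z` at the `α`-th tree. The sign
may depend on the pair of branches. -/
structure IsRigidFamily (b : Set.Iio lam.ord → Base F A) (α : Set.Iio lam.ord)
    (β : Ordinal.{v}) (T : Set (ℕ → Bool)) (t : T → Hat F A s) (z : Hat F A s) : Prop where
  subset : T ⊆ F.V α
  card : Cardinal.lift.{v} #T = kap
  mem : ∀ v, t v ∈ chain F s b β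
  rigid : ∀ v w : T, v ≠ w →
    (∃ x ∈ G F s b, t v - t w + q s (br v w) • z = q s (br v w + 1) • x) ∨
    (∃ x ∈ G F s b, t v - t w - q s (br v w) • z = q s (br v w + 1) • x)

end Construction

end RigidTree

end

/-! Some multiple `q s n • t v` of each tree-element is a finite combination of base elements and
branch elements starting at height 0 (`exists_normal_form`). A height `N` and a finite set `Q ⊆ A`
control this normal form (`HasProfile`). There are at most max(ℵ₀, |A|) < κ triples `(n, N, Q)`, so
infinitely many `v` share one, and some pairs among these branch at arbitrarily large `k`. Such a
`k` lies in `F.C α`.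

Compare two of these multiples modulo q_{k+1}. At nodes of height `k`, the multiple q_n z
contributes only multiples of a fixed q_M for which elements of `Q` congruent modulo q_M are equal.
So the branch coefficients agree node by node. What survives is the difference of the base parts and
the terms q_k v(k) g; by almost disjointness only branches of the `α`-th tree have value 1 at `k`.
The base parts agree for the same reason. Since q_{k+1} = s_k q_k², dividing by q_k leaves q_n z ≡ a
g_α modulo q_k, with `a` a difference of elements of `Q` (`HasProfile.exists_eq_smul_add`).

Finitely many `a` serve unboundedly many `k`, so one of them gives q_n z = a g_α. Either g_α = 0 or
B/Ag_α is free, and in both cases q_n can be cancelled. -/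

noncomputable section

namespace RigidTree

/-! ### Divisibility by the chain `q` -/

section Divisibility

variable {R : Type u} [CommRing R]

theorem qRatio_zero (s : ℕ → R) (j : ℕ) : qRatio s 0 j = q s j := by
  have h := q_add s 0 j
  simpa [q] using h.symm

theorem q_dvd_q (s : ℕ → R) {m n : ℕ} (h : m ≤ n) : q s m ∣ q s n := by
  obtain ⟨j, rfl⟩ := Nat.exists_eq_add_of_le h
  rw [q_add]
  exact Dvd.intro_left _ rfl

theorem q_ne_zero [IsDomain R] {s : ℕ → R} (hs : Set.range s = {r : R | r ≠ 0}) (n : ℕ) :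
    q s n ≠ 0 := by
  induction n with
  | zero => simp [q]
  | succ n ih =>
    have h : s n ∈ {r : R | r ≠ 0} := hs ▸ Set.mem_range_self n
    exact mul_ne_zero h (pow_ne_zero 2 ih)

/-- If `r ≠ 0` and `p` is a nonzero nonunit, then `r * p` is some `s n`; divisibility of `r` by `q s
(n + 1) = r * p * q s n ^ 2` would make `p` a unit. -/
theorem eq_zero_of_forall_q_dvd [IsDomain R] (hR : ¬ IsField R) {s : ℕ → R}
    (hs : Set.range s = {r : R | r ≠ 0}) {r : R} (h : ∀ n, q s n ∣ r) : r = 0 := by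
  by_contra hr
  obtain ⟨p, hp0, hp⟩ := Ring.exists_not_isUnit_of_not_isField hR
  obtain ⟨n, hn⟩ : r * p ∈ Set.range s := hs ▸ mul_ne_zero hr hp0
  obtain ⟨c, hc⟩ := h (n + 1)
  refine hp (IsUnit.of_mul_eq_one (q s n ^ 2 * c) (mul_left_cancel₀ hr ?_))
  rw [mul_one]
  conv_rhs => rw [hc, q, hn]
  ring

/-- In a free module the submodules `q n A` have zero intersection. -/
theorem eq_zero_of_forall_q_smul [IsDomain R] (hR : ¬ IsField R) {s : ℕ → R}
    (hs : Set.range s = {r : R | r ≠ 0}) {A : Type v} [AddCommGroup A] [Module R A]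
    [Module.Free R A] {a : A} (h : ∀ n, ∃ y : A, a = q s n • y) : a = 0 := by
  let e := Module.Free.chooseBasis R A
  refine e.ext_elem fun i => ?_
  rw [map_zero, Finsupp.zero_apply]
  refine eq_zero_of_forall_q_dvd hR hs fun n => ?_
  obtain ⟨y, rfl⟩ := h n
  simp

/-- On a finite set of elements of a free module, divisibility by one `q M` detects `0`. -/
theorem exists_q_detects_zero [IsDomain R] (hR : ¬ IsField R) {s : ℕ → R}
    (hs : Set.range s = {r : R | r ≠ 0}) {A : Type v} [AddCommGroup A] [Module R A]
    [Module.Free R A] (D : Finset A) :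
    ∃ M, ∀ a ∈ D, (∃ y : A, a = q s M • y) → a = 0 := by
  classical
  induction D using Finset.induction_on with
  | empty => exact ⟨0, by simp⟩
  | insert a D _ ih =>
    obtain ⟨M, hM⟩ := ih
    have mono : ∀ {K L : ℕ} (x : A), K ≤ L → (∃ y : A, x = q s L • y) → ∃ y : A, x = q s K • y := by
      rintro K L x hKL ⟨y, rfl⟩
      obtain ⟨c, hc⟩ := q_dvd_q s hKL
      exact ⟨c • y, by rw [hc, mul_smul]⟩
    by_cases ha : a = 0
    · refine ⟨M, fun x hx => ?_⟩
      rcases Finset.mem_insert.1 hx with rfl | hx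
      · exact fun _ => ha
      · exact hM x hx
    · obtain ⟨K, hK⟩ : ∃ K, ¬ ∃ y : A, a = q s K • y := by
        by_contra! hcon
        exact ha (eq_zero_of_forall_q_smul hR hs hcon)
      refine ⟨max M K, fun x hx hy => ?_⟩
      rcases Finset.mem_insert.1 hx with rfl | hx
      · exact absurd (mono _ (le_max_right M K) hy) hK
      · exact hM x hx (mono _ (le_max_left M K) hy)

end Divisibility

/-! ### Components of elements of the completion -/

section Completion

variable {R : Type u} [CommRing R] {A : Type v} [Ring A] [Algebra R A] {s : ℕ → R}
  {M : Type w} [AddCommGroup M] [Module R M] [Module A M] [IsScalarTower R A M]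

theorem Completion.component_of_le (x : Completion A s M) {k l : ℕ} (h : k ≤ l) {y : M}
    (hy : x.1 l = Submodule.Quotient.mk y) : x.1 k = Submodule.Quotient.mk y := by
  induction l, h using Nat.le_induction generalizing y with
  | base => exact hy
  | succ l _ ih =>
    refine ih ?_
    rw [← x.2 l, hy]
    rfl

theorem q_smul_quotient_eq_zero {k l : ℕ} (h : k ≤ l) (x : M ⧸ qSub A s M k) :
    q s l • x = 0 := by
  obtain ⟨y, rfl⟩ := Submodule.Quotient.mk_surjective _ x
  obtain ⟨c, hc⟩ := q_dvd_q s h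
  rw [← Submodule.Quotient.mk_smul, Submodule.Quotient.mk_eq_zero]
  exact ⟨c • y, by rw [hc, mul_smul]⟩

theorem Completion.eq_zero_of_q_smul_eq_zero [IsDomain R]
    (hs : Set.range s = {r : R | r ≠ 0}) [Module.IsTorsionFree R M] {x : Completion A s M} {n : ℕ}
    (h : q s n • x = 0) : x = 0 := by
  refine Subtype.ext (funext fun k => ?_)
  -- Cancelling `q s n` costs precision. At level `n + (k + 1)` enough is left, because `q s k`
  -- divides `qRatio s n (k + 1)`.
  obtain ⟨y, hy⟩ := Submodule.Quotient.mk_surjective _ (x.1 (n + (k + 1)))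
  rw [Completion.component_of_le x (by omega : k ≤ n + (k + 1)) hy.symm]
  have h1 : q s n • x.1 (n + (k + 1)) = 0 := congrFun (congrArg Subtype.val h) _
  rw [← hy, ← Submodule.Quotient.mk_smul, Submodule.Quotient.mk_eq_zero] at h1
  obtain ⟨y', hy'⟩ := h1
  obtain ⟨c, hc⟩ := q_dvd_qRatio s n k
  refine (Submodule.Quotient.mk_eq_zero _).2 ⟨c • y', ?_⟩
  refine smul_right_injective M (q_ne_zero hs n) ?_
  change q s n • y = q s n • q s k • c • y'
  rw [hy', q_add, hc, smul_smul, smul_smul]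
  congr 1
  ring

/-- Splitting off the first `n` summands of a series. -/
theorem series_zero_eq (n : ℕ) (x : ℕ → Completion A s M) :
    series A s 0 x
      = ∑ j ∈ Finset.range n, q s j • x j + q s n • series A s n fun j => x (n + j) := by
  refine Subtype.ext (funext fun k => ?_)
  have e : ∀ (m : ℕ) (f : ℕ → Completion A s M),
      (∑ j ∈ Finset.range m, f j).1 k = ∑ j ∈ Finset.range m, (f j).1 k := by
    intro m f
    simp [Finset.sum_apply]
  change (∑ j ∈ Finset.range (k + 1), qRatio s 0 j • x j).1 k
    = (∑ j ∈ Finset.range n, q s j • x j).1 k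
      + q s n • (∑ j ∈ Finset.range (k + 1), qRatio s n j • x (n + j)).1 k
  rw [e, e, e, Finset.smul_sum]
  have h1 : ∀ j, q s n • (qRatio s n j • x (n + j)).1 k = (q s (n + j) • x (n + j)).1 k := by
    intro j
    change q s n • qRatio s n j • (x (n + j)).1 k = q s (n + j) • (x (n + j)).1 k
    rw [smul_smul, q_add, mul_comm]
  simp only [h1, qRatio_zero]
  -- Both sides are initial segments of one sum with `n + (k + 1)` terms; the terms from index `k +
  -- 1` on vanish modulo `q s k`.
  rw [← Finset.sum_range_add (fun j => (q s j • x j).1 k) n (k + 1),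
    Nat.add_comm n (k + 1), Finset.sum_range_add _ (k + 1) n]
  symm
  refine add_eq_left.2 (Finset.sum_eq_zero fun j _ => ?_)
  exact q_smul_quotient_eq_zero (by omega) _

end Completion

/-! ### Branches of the forest -/

theorem restr_length (v : ℕ → Bool) (n : ℕ) : (restr v n).length = n := by simp [restr]

theorem restr_eq_iff {v w : ℕ → Bool} {n : ℕ} :
    restr v n = restr w n ↔ ∀ l < n, v l = w l := by
  simp [restr]

theorem apply_br_ne {v w : ℕ → Bool} (h : v ≠ w) : v (br v w) ≠ w (br v w) :=
  Nat.sInf_mem (s := {n | v n ≠ w n}) (Function.ne_iff.1 h)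

theorem le_br {v w : ℕ → Bool} (h : v ≠ w) {n : ℕ} (hn : ∀ l < n, v l = w l) : n ≤ br v w := by
  by_contra! hlt
  exact apply_br_ne h (hn _ hlt)

/-- An infinite set of branches contains pairs that branch arbitrarily late. -/
theorem exists_le_br {T : Set (ℕ → Bool)} (hT : T.Infinite) (n : ℕ) :
    ∃ v ∈ T, ∃ w ∈ T, v ≠ w ∧ n ≤ br v w := by
  have := hT.to_subtype
  obtain ⟨v, w, hvw, h⟩ :=
    Finite.exists_ne_map_eq_of_infinite fun (v : T) (l : Fin n) => v.1 l
  have hne : v.1 ≠ w.1 := fun h => hvw (Subtype.ext h)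
  exact ⟨v, v.2, w, w.2, hne, le_br hne fun l hl => congrFun h ⟨l, hl⟩⟩

section Forest

variable {kap lam : Cardinal.{v}} (F : Forest kap lam)

/-- The chosen infinite branches of all trees of the forest. -/
def Forest.Branch : Type (v + 1) := Σ γ : Set.Iio lam.ord, F.V γ

variable {F}

/-- The node of height `l` on a branch. -/
def Forest.Branch.node (l : ℕ) (i : F.Branch) : F.Node :=
  ⟨i.1, restr i.2.1 l, F.V_branch i.1 i.2.1 i.2.2 l⟩

/-- The height of a node. -/
def Forest.Node.height (τ : F.Node) : ℕ := τ.2.1.length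

theorem Forest.Branch.height_node (l : ℕ) (i : F.Branch) : (i.node l).height = l :=
  restr_length _ _

theorem Forest.Branch.fst_eq_of_node_eq {l : ℕ} {i i' : F.Branch} (h : i.node l = i'.node l) :
    i.1 = i'.1 :=
  congrArg (fun τ : F.Node => τ.1) h

theorem Forest.Branch.restr_eq_of_node_eq {l : ℕ} {i i' : F.Branch} (h : i.node l = i'.node l) :
    restr i.2.1 l = restr i'.2.1 l :=
  congrArg (fun τ : F.Node => τ.2.1) h

theorem Forest.Branch.node_eq {l : ℕ} {i i' : F.Branch} (h : i.1 = i'.1)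
    (h' : restr i.2.1 l = restr i'.2.1 l) : i.node l = i'.node l := by
  obtain ⟨γ, v, hv⟩ := i
  obtain ⟨γ', v', hv'⟩ := i'
  obtain rfl : γ = γ' := h
  simp only [Forest.Branch.node] at h' ⊢
  congr 1
  exact Subtype.ext h'

theorem Forest.Branch.ext_fun {i i' : F.Branch} (h : i.2.1 = i'.2.1) : i = i' := by
  obtain ⟨γ, v, hv⟩ := i
  obtain ⟨γ', v', hv'⟩ := i'
  obtain rfl : v = v' := h
  obtain rfl : γ = γ' := by
    by_contra hne
    exact Set.disjoint_left.1 (F.V_disjoint _ _ hne) hv hv'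
  rfl

theorem Forest.mem_C_of_apply {γ : Set.Iio lam.ord} {v : ℕ → Bool} (hv : v ∈ F.V γ) {k : ℕ}
    (hk : v k = true) : k ∈ F.C γ := by
  by_contra hC
  have h := F.tree_subset γ (F.V_branch γ v hv (k + 1)) k (by simp [restr]) hC
  simp [restr, hk] at h

/-- Finitely many branches are separated by their nodes from some height on. -/
theorem Forest.exists_injOn_node (S : Finset F.Branch) :
    ∃ N, ∀ k, N ≤ k → Set.InjOn (Forest.Branch.node k) (S : Set F.Branch) := by
  classical
  -- Diagonal pairs do no harm: there `br` is the infimum of the empty set, which is 0.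
  obtain ⟨N, hN⟩ := ((S ×ˢ S).image fun p => br p.1.2.1 p.2.2.1 + 1).exists_le
  refine ⟨N, fun k hk i hi i' hi' h => ?_⟩
  refine Forest.Branch.ext_fun ?_
  by_contra hne
  have h1 := hN _ (Finset.mem_image_of_mem _ (Finset.mk_mem_product hi hi'))
  exact apply_br_ne hne
    (restr_eq_iff.1 (Forest.Branch.restr_eq_of_node_eq h) _ (by dsimp at h1; omega))

end Forest

/-! ### Normal forms for the elements of the chain -/

section Normal

variable {kap lam : Cardinal.{v}} {F : Forest kap lam}
  {R : Type u} [CommRing R] {A : Type v} [Ring A] [Algebra R A] {s : ℕ → R}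

/-- The summand with index `l` of the branch element at `i`. -/
def summand (g : Set.Iio lam.ord → Base F A) (i : F.Branch) (l : ℕ) : Base F A :=
  Finsupp.single (i.node l) 1 + if i.2.1 l then g i.1 else 0

variable (s) in
/-- The branch element starting at height `0`. -/
def rootElt (g : Set.Iio lam.ord → Base F A) (i : F.Branch) : Hat F A s :=
  branchElt F A s i.1 i.2 0 (emb F A s (g i.1))

variable (s) in
/-- The part of the branch element up to height `k`. -/
def head (g : Set.Iio lam.ord → Base F A) (k : ℕ) (i : F.Branch) : Base F A :=
  ∑ l ∈ Finset.range (k + 1), q s l • summand g i l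

theorem toCompletion_q_smul {M : Type w} [AddCommGroup M] [Module R M] [Module A M]
    [IsScalarTower R A M] (r : R) (x : M) :
    toCompletion A s M (r • x) = r • toCompletion A s M x := rfl

theorem branchElt_eq_series (g : Set.Iio lam.ord → Base F A) (i : F.Branch) (n : ℕ) :
    branchElt F A s i.1 i.2 n (emb F A s (g i.1))
      = series A s n fun j => emb F A s (summand g i (n + j)) := by
  unfold branchElt
  congr 1
  funext j
  rw [summand, map_add]
  congr 1
  split_ifs
  · rfl
  · exact (map_zero _).symm

theorem rootElt_eq (g : Set.Iio lam.ord → Base F A) (i : F.Branch) (n : ℕ) :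
    rootElt s g i = emb F A s (∑ l ∈ Finset.range n, q s l • summand g i l)
      + q s n • branchElt F A s i.1 i.2 n (emb F A s (g i.1)) := by
  rw [rootElt, branchElt_eq_series, branchElt_eq_series]
  simp only [Nat.zero_add]
  rw [series_zero_eq n, map_sum]
  rfl

/-- Modulo `q s (k + 1)` the last surviving summand has height `k`; it is the one that sees the
value of the branch at `k`. -/
theorem rootElt_component (g : Set.Iio lam.ord → Base F A) (i : F.Branch) (k : ℕ) :
    (rootElt s g i).1 (k + 1) = Submodule.Quotient.mk (head s g k i) := by
  rw [rootElt_eq g i (k + 1)]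
  change Submodule.Quotient.mk (head s g k i) + q s (k + 1) •
    (branchElt F A s i.1 i.2 (k + 1) (emb F A s (g i.1))).1 (k + 1) = _
  rw [q_smul_quotient_eq_zero le_rfl, add_zero]

variable (s) in
/-- The elements with a multiple `q n x` in the submodule generated by the base module and the
branch elements starting at height `0`. -/
def rootHull (g : Set.Iio lam.ord → Base F A) : Submodule A (Hat F A s) where
  carrier := {x | ∃ n, q s n • x ∈
    LinearMap.range (emb F A s) ⊔ Submodule.span A (Set.range (rootElt s g))}
  zero_mem' := ⟨0, by simp⟩
  add_mem' := by
    rintro x y ⟨m, hm⟩ ⟨n, hn⟩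
    obtain ⟨c, hc⟩ := q_dvd_q s (le_max_left m n)
    obtain ⟨d, hd⟩ := q_dvd_q s (le_max_right m n)
    refine ⟨max m n, ?_⟩
    rw [smul_add]
    refine add_mem ?_ ?_
    · rw [hc, mul_comm, mul_smul, ← algebraMap_smul A c]
      exact Submodule.smul_mem _ _ hm
    · rw [hd, mul_comm, mul_smul, ← algebraMap_smul A d]
      exact Submodule.smul_mem _ _ hn
  smul_mem' := by
    rintro a x ⟨n, hn⟩
    exact ⟨n, by rw [smul_comm]; exact Submodule.smul_mem _ _ hn⟩

/-- By `rootElt_eq`, `q s n` times a branch element starting at height `n` differs from the one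
starting at height 0 by a base element. -/
theorem chain_le_rootHull (b : Set.Iio lam.ord → Base F A) (β : Ordinal.{v}) :
    chain F s b β ≤ rootHull s (gElt F s b) := by
  induction β using Ordinal.limitRecOn with
  | zero =>
    rw [chain, Ordinal.limitRecOn_zero]
    exact bot_le
  | add_one β ih =>
    rw [chain, Ordinal.limitRecOn_add_one]
    split_ifs with h
    · refine Submodule.span_le.2 (Set.union_subset (Set.union_subset ih ?_) ?_)
      · rintro _ ⟨τ, rfl⟩
        refine ⟨0, ?_⟩
        rw [q, one_smul]
        exact Submodule.mem_sup_left ⟨_, rfl⟩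
      · rintro _ ⟨v, n, rfl⟩
        refine ⟨n, ?_⟩
        have h1 := rootElt_eq (s := s) (gElt F s b) ⟨⟨β, h⟩, v⟩ n
        have h2 := eq_sub_of_add_eq' h1.symm
        change q s n • branchElt F A s ⟨β, h⟩ v n (emb F A s (gElt F s b ⟨β, h⟩)) ∈ _
        rw [h2]
        exact sub_mem (Submodule.mem_sup_right (Submodule.subset_span ⟨_, rfl⟩))
          (Submodule.mem_sup_left ⟨_, rfl⟩)
    · exact ih
  | limit δ hδ ih =>
    rw [chain, Ordinal.limitRecOn_limit _ _ _ _ hδ]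
    exact iSup_le fun γ => ih γ.1 γ.2

theorem exists_normal_form (b : Set.Iio lam.ord → Base F A) {β : Ordinal.{v}} {x : Hat F A s}
    (hx : x ∈ chain F s b β) :
    ∃ (n : ℕ) (f : Base F A) (c : F.Branch →₀ A),
      q s n • x = emb F A s f + c.sum fun i a => a • rootElt s (gElt F s b) i := by
  obtain ⟨n, hn⟩ := chain_le_rootHull b β hx
  obtain ⟨_, ⟨f, rfl⟩, y, hy, h⟩ := Submodule.mem_sup.1 hn
  obtain ⟨c, rfl⟩ := Finsupp.mem_span_range_iff_exists_finsupp.1 hy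
  exact ⟨n, f, c, h.symm⟩

theorem normal_form_component (g : Set.Iio lam.ord → Base F A) (f : Base F A) (c : F.Branch →₀ A)
    (k : ℕ) :
    (emb F A s f + c.sum fun i a => a • rootElt s g i).1 (k + 1)
      = Submodule.Quotient.mk (f + c.sum fun i a => a • head s g k i) := by
  have h : ((c.sum fun i a => a • rootElt s g i : Hat F A s)).1 (k + 1)
      = Submodule.Quotient.mk (c.sum fun i a => a • head s g k i) := by
    rw [Finsupp.sum, Finsupp.sum, ← Submodule.mkQ_apply, map_sum, AddSubmonoidClass.coe_finsetSum,
      Finset.sum_apply]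
    refine Finset.sum_congr rfl fun i _ => ?_
    change c i • (rootElt s g i).1 (k + 1) = _
    rw [rootElt_component]
    rfl
  rw [Submodule.Quotient.mk_add, ← h]
  rfl

end Normal

/-! ### Comparison of two normal forms of the same profile -/

section Profile

variable {kap lam : Cardinal.{v}} {F : Forest kap lam}
  {R : Type u} [CommRing R] {A : Type v} [Ring A] [Algebra R A] {s : ℕ → R}

/-- The height `N` and the finite set `Q` control the normal form `f + ∑ c i y_i`. -/
structure HasProfile (g : Set.Iio lam.ord → Base F A) (α : Set.Iio lam.ord) (N : ℕ) (Q : Finset A)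
    (f : Base F A) (c : F.Branch →₀ A) : Prop where
  height_base : ∀ τ ∈ f.support, τ.height < N
  height_g : ∀ i ∈ c.support, ∀ τ ∈ (g i.1).support, τ.height < N
  injOn : ∀ k, N ≤ k → Set.InjOn (Forest.Branch.node k) (c.support : Set F.Branch)
  inter_lt : ∀ i ∈ c.support, i.1 ≠ α → ∀ k ∈ F.C α ∩ F.C i.1, k < N
  base_mem : ∀ τ, f τ ∈ Q
  sum_mem : ∀ S ⊆ c.support, ∑ i ∈ S, c i ∈ Q

/-- Finite supports and almost disjointness leave only finitely many bounds and values to collect.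
-/
theorem exists_hasProfile (g : Set.Iio lam.ord → Base F A) (α : Set.Iio lam.ord) (f : Base F A)
    (c : F.Branch →₀ A) : ∃ N Q, HasProfile g α N Q f c := by
  classical
  obtain ⟨N₁, h₁⟩ := (f.support.image fun τ => τ.height + 1).exists_le
  obtain ⟨N₂, h₂⟩ := (c.support.biUnion fun i =>
    (g i.1).support.image fun τ => τ.height + 1).exists_le
  obtain ⟨N₃, h₃⟩ := Forest.exists_injOn_node c.support
  have hex : ∀ i : F.Branch, ∃ n, i.1 ≠ α → ∀ k ∈ F.C α ∩ F.C i.1, k < n := by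
    intro i
    by_cases hi : i.1 = α
    · exact ⟨0, fun h => absurd hi h⟩
    · obtain ⟨n, hn⟩ := (F.C_almostDisjoint α i.1 (Ne.symm hi)).bddAbove
      exact ⟨n + 1, fun _ k hk => Nat.lt_succ_of_le (hn hk)⟩
  choose d hd using hex
  obtain ⟨N₄, h₄⟩ := (c.support.image d).exists_le
  refine ⟨max (max N₁ N₂) (max N₃ N₄), insert 0 (f.support.image f) ∪
    c.support.powerset.image fun S => ∑ i ∈ S, c i, ?_, ?_, ?_, ?_, ?_, ?_⟩
  · intro τ hτ
    have := h₁ _ (Finset.mem_image_of_mem _ hτ)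
    simp only [lt_max_iff]
    omega
  · intro i hi τ hτ
    have := h₂ _ (Finset.mem_biUnion.2 ⟨i, hi, Finset.mem_image_of_mem _ hτ⟩)
    simp only [lt_max_iff]
    omega
  · intro k hk
    exact h₃ k (by simp only [max_le_iff] at hk; omega)
  · intro i hi hne k hk
    have h5 := h₄ _ (Finset.mem_image_of_mem _ hi)
    have h6 := hd i hne k hk
    simp only [lt_max_iff]
    omega
  · intro τ
    refine Finset.mem_union_left _ (Finset.mem_insert.2 ?_)
    by_cases h : f τ = 0
    · exact Or.inl h
    · exact Or.inr (Finset.mem_image_of_mem _ (Finsupp.mem_support_iff.2 h))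
  · intro S hS
    exact Finset.mem_union_right _ (Finset.mem_image_of_mem _ (Finset.mem_powerset.2 hS))

variable {g : Set.Iio lam.ord → Base F A} {α : Set.Iio lam.ord} {N : ℕ} {Q : Finset A}
  {f f' : Base F A} {c c' : F.Branch →₀ A} {k : ℕ}

/-- The node summands below the last live at heights less than `k`, and so does the support of `g
i.1`. -/
theorem head_apply_of_height {i : F.Branch} (hg : ∀ τ ∈ (g i.1).support, τ.height < k)
    {τ : F.Node} (hτ : τ.height = k) :
    head s g k i τ = q s k • Finsupp.single (i.node k) (1 : A) τ := by
  have hg0 : g i.1 τ = 0 := by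
    by_contra h
    exact (hg τ (Finsupp.mem_support_iff.2 h)).ne hτ
  have hsum : ∀ l, summand g i l τ = Finsupp.single (i.node l) (1 : A) τ := by
    intro l
    rw [summand, Finsupp.add_apply]
    split_ifs <;> simp [hg0]
  rw [head, Finsupp.finsetSum_apply, Finset.sum_range_succ, Finset.sum_eq_zero, zero_add,
    Finsupp.smul_apply, hsum]
  intro l hl
  rw [Finsupp.smul_apply, hsum, Finsupp.single_eq_of_ne, smul_zero]
  rintro rfl
  rw [Forest.Branch.height_node] at hτ
  exact (Finset.mem_range.1 hl).ne hτ

theorem HasProfile.apply_of_height (h : HasProfile g α N Q f c) (hk : N ≤ k) {τ : F.Node}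
    (hτ : τ.height = k) :
    (f + c.sum fun i a => a • head s g k i) τ
      = q s k • Finsupp.mapDomain (Forest.Branch.node k) c τ := by
  have hf : f τ = 0 := by
    by_contra h0
    have := h.height_base τ (Finsupp.mem_support_iff.2 h0)
    omega
  rw [Finsupp.add_apply, hf, zero_add, Finsupp.mapDomain, Finsupp.sum, Finsupp.sum,
    Finsupp.finsetSum_apply, Finsupp.finsetSum_apply, Finset.smul_sum]
  refine Finset.sum_congr rfl fun i hi => ?_
  rw [Finsupp.smul_apply,
    head_apply_of_height (fun τ hτ => (h.height_g i hi τ hτ).trans_le hk) hτ, smul_comm]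
  congr 1
  classical
  simp [Finsupp.single_apply]

theorem HasProfile.zero_mem (h : HasProfile g α N Q f c) : (0 : A) ∈ Q := by
  simpa using h.sum_mem ∅ (Finset.empty_subset _)

/-- From height `N` on the branches in the support pass through distinct nodes, so no two
coefficients are added. -/
theorem HasProfile.mapDomain_mem (h : HasProfile g α N Q f c) (hk : N ≤ k) (τ : F.Node) :
    Finsupp.mapDomain (Forest.Branch.node k) c τ ∈ Q := by
  classical
  by_cases h0 : Finsupp.mapDomain (Forest.Branch.node k) c τ = 0
  · rw [h0]
    exact h.zero_mem
  · obtain ⟨i, hi, rfl⟩ := Finset.mem_image.1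
      (Finsupp.mapDomain_support (Finsupp.mem_support_iff.2 h0))
    rw [Finsupp.mapDomain_apply' _ c subset_rfl (h.injOn k hk) hi]
    simpa using h.sum_mem {i} (Finset.singleton_subset_iff.2 hi)

/-- The part of `head s g k i` which depends on the node of height `k` only. -/
theorem exists_head_eq (g : Set.Iio lam.ord → Base F A) (k : ℕ) :
    ∃ e : F.Node → Base F A, ∀ i : F.Branch,
      head s g k i = e (i.node k) + q s k • if i.2.1 k then g i.1 else 0 := by
  let e₀ : F.Branch → Base F A := fun i =>
    ∑ l ∈ Finset.range k, q s l • summand g i l + q s k • Finsupp.single (i.node k) 1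
  -- The node of height `k` records the tree and all values of the branch below `k`, but not the
  -- value at `k`.
  have he : Function.FactorsThrough e₀ (Forest.Branch.node k) := by
    intro i i' hii
    have h1 := Forest.Branch.fst_eq_of_node_eq hii
    have h2 := restr_eq_iff.1 (Forest.Branch.restr_eq_of_node_eq hii)
    simp only [e₀]
    rw [hii]
    congr 1
    refine Finset.sum_congr rfl fun l hl => ?_
    have hl := Finset.mem_range.1 hl
    have h3 := Forest.Branch.node_eq h1 (restr_eq_iff.2 fun j hj => h2 j (hj.trans hl))
    have h4 : g i.1 = g i'.1 := congrArg g h1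
    rw [summand, summand, h3, h2 l hl, h4]
  refine ⟨Function.extend (Forest.Branch.node k) e₀ 0, fun i => ?_⟩
  rw [he.extend_apply, head, Finset.sum_range_succ]
  conv_lhs => rw [summand.eq_def g i k, smul_add]
  rw [add_assoc]

/-- A branch of another tree with value 1 at `k` would put `k ≥ N` into the intersection of two
almost disjoint sets, against `inter_lt`. -/
theorem HasProfile.exists_sum_eq (h : HasProfile g α N Q f c) (hk : N ≤ k) (hC : k ∈ F.C α) :
    ∃ a ∈ Q, (c.sum fun i a => a • if i.2.1 k then g i.1 else 0) = a • g α := by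
  classical
  -- The branches selected here vary with `k`; hence `sum_mem` asks for all subset sums.
  refine ⟨∑ i ∈ c.support.filter fun i => i.2.1 k = true, c i,
    h.sum_mem _ (Finset.filter_subset _ _), ?_⟩
  rw [Finset.sum_smul, Finset.sum_filter, Finsupp.sum]
  refine Finset.sum_congr rfl fun i hi => ?_
  split_ifs with hik
  · by_cases hα : i.1 = α
    · rw [hα]
    · exact absurd (h.inter_lt i hi hα k ⟨hC, Forest.mem_C_of_apply i.2.2 hik⟩) (by omega)
  · rw [smul_zero]

/-- Two normal forms of the same profile which differ by `q k ζ` modulo `q (k + 1)`. -/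
theorem HasProfile.exists_eq_smul_add [IsDomain R] [Module.Free R A]
    (hs : Set.range s = {r : R | r ≠ 0}) (h : HasProfile g α N Q f c)
    (h' : HasProfile g α N Q f' c') (hk : N ≤ k) (hC : k ∈ F.C α) {M : ℕ} (hM : M ≤ k)
    (hQ : ∀ a ∈ Q, ∀ a' ∈ Q, (∃ y : A, a - a' = q s M • y) → a = a') {ζ y : Base F A}
    (hζ : ∀ τ : F.Node, τ.height = k → ∃ x : A, ζ τ = q s M • x)
    (heq : (f + c.sum fun i a => a • head s g k i) - (f' + c'.sum fun i a => a • head s g k i)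
      + q s k • ζ = q s (k + 1) • y) :
    ∃ a ∈ Q, ∃ a' ∈ Q, ∃ x : Base F A, ζ = (a' - a) • g α + q s k • x := by
  have hq := q_ne_zero hs k
  -- The square in the recursion pays off here: after division by `q s k` the modulus is still a
  -- multiple of `q s k`, hence of `q s M`.
  have hsucc : q s (k + 1) = q s k * (q s k * s k) := by rw [q]; ring
  obtain ⟨d, hd⟩ := q_dvd_q s hM
  have hmap : Finsupp.mapDomain (Forest.Branch.node k) c
      = Finsupp.mapDomain (Forest.Branch.node k) c' := by
    ext τ
    by_cases hτ : τ.height = k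
    · refine hQ _ (h.mapDomain_mem hk τ) _ (h'.mapDomain_mem hk τ) ?_
      obtain ⟨x, hx⟩ := hζ τ hτ
      have e := DFunLike.congr_fun heq τ
      rw [Finsupp.add_apply, Finsupp.sub_apply, h.apply_of_height hk hτ,
        h'.apply_of_height hk hτ, Finsupp.smul_apply, Finsupp.smul_apply, hx, hsucc, mul_smul,
        ← smul_sub, ← smul_add] at e
      have e' := smul_right_injective A hq e
      refine ⟨(d * s k) • y τ - x, ?_⟩
      rw [smul_sub, smul_smul, ← mul_assoc, ← hd]
      exact eq_sub_of_add_eq e'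
    · have hz : ∀ c : F.Branch →₀ A, Finsupp.mapDomain (Forest.Branch.node k) c τ = 0 := by
        intro c
        refine Finsupp.mapDomain_of_notMem_range _ _ ?_
        rintro ⟨i, rfl⟩
        exact hτ (Forest.Branch.height_node k i)
      rw [hz, hz]
  obtain ⟨e, he⟩ := exists_head_eq (s := s) g k
  have hsum : ∀ c : F.Branch →₀ A, (c.sum fun i a => a • head s g k i)
      = ((Finsupp.mapDomain (Forest.Branch.node k) c).sum fun τ a => a • e τ)
        + q s k • c.sum fun i a => a • if i.2.1 k then g i.1 else 0 := by
    intro c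
    rw [Finsupp.sum_mapDomain_index (h := fun τ a => a • e τ) (fun _ => zero_smul _ _)
      (fun _ _ _ => add_smul _ _ _), Finsupp.smul_sum, ← Finsupp.sum_add]
    refine Finset.sum_congr rfl fun i _ => ?_
    simp only [he i, smul_add]
    rw [smul_comm]
  obtain ⟨a, ha, hae⟩ := h.exists_sum_eq hk hC
  obtain ⟨a', ha', hae'⟩ := h'.exists_sum_eq hk hC
  rw [hsum c, hsum c', hmap, hae, hae', hsucc, mul_smul] at heq
  have hff : f - f' = q s k • ((q s k * s k) • y - ζ - (a - a') • g α) := by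
    rw [smul_sub, smul_sub, ← heq, sub_smul, smul_sub]
    abel
  -- The base parts differ by a multiple of `q s k`, so their coordinates, which lie in `Q`, are
  -- congruent modulo `q s M`.
  have hf : f = f' := by
    ext τ
    refine hQ _ (h.base_mem τ) _ (h'.base_mem τ) ?_
    refine ⟨d • ((q s k * s k) • y - ζ - (a - a') • g α) τ, ?_⟩
    rw [smul_smul, ← hd]
    exact DFunLike.congr_fun hff τ
  rw [hf, sub_self] at hff
  have h0 := smul_right_injective (Base F A) hq
    ((hff.symm.trans (smul_zero (q s k)).symm))
  refine ⟨a, ha, a', ha', s k • y, ?_⟩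
  rw [smul_smul]
  rw [sub_sub, sub_eq_zero] at h0
  rw [h0, sub_smul, sub_smul]
  abel

end Profile

/-! ### Families of rigid tree-elements -/

section Family

variable {kap lam : Cardinal.{v}} {F : Forest kap lam}
  {R : Type u} [CommRing R] {A : Type v} [Ring A] [Algebra R A] {s : ℕ → R}

/-- The cardinal |A|⁺ + ℵ₁ exceeds both ℵ₀ and |A|, hence the number of possible values of `Φ`. -/
theorem exists_infinite_fiber_of_card {T : Type} {A : Type v}
    (hT : Cardinal.lift.{v} #T = Order.succ #A + ℵ₁) (Φ : T → ℕ × ℕ × Finset A) :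
    ∃ p, Infinite (Φ ⁻¹' {p}) := by
  classical
  have hfin : #(Finset A) ≤ max ℵ₀ #A :=
    (mk_le_of_surjective (List.toFinset_surjective (α := A))).trans (mk_list_le_max A)
  have hcard : #(ULift.{v} (ℕ × ℕ × Finset A)) ≤ max ℵ₀ #A := by
    simp only [mk_uLift, mk_prod, lift_id, lift_uzero, mk_nat, lift_aleph0]
    refine (mul_le_max _ _).trans (max_le (max_le (le_max_left _ _) ?_) (le_max_left _ _))
    refine (mul_le_max _ _).trans (max_le (max_le (le_max_left _ _) hfin) (le_max_left _ _))
  have hlt : max ℵ₀ #A < #(ULift.{v} T) := by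
    rw [mk_uLift, hT]
    refine max_lt ?_ ?_
    · exact aleph0_lt_aleph_one.trans_le (self_le_add_left _ _)
    · exact (Order.lt_succ _).trans_le (self_le_add_right _ _)
  have : Infinite (ULift.{v} T) := infinite_iff.2 ((le_max_left _ _).trans hlt.le)
  obtain ⟨⟨p⟩, hp⟩ := exists_infinite_fiber
    (fun v : ULift.{v} T => (ULift.up (Φ v.down) : ULift.{v} (ℕ × ℕ × Finset A)))
    (hcard.trans_lt hlt)
  refine ⟨p, Infinite.of_injective
    (fun v : ↥((fun v : ULift.{v} T => (ULift.up (Φ v.down) : ULift.{v} (ℕ × ℕ × Finset A))) ⁻¹'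
      {ULift.up p}) => (⟨v.1.down, congrArg ULift.down v.2⟩ : ↥(Φ ⁻¹' {p}))) ?_⟩
  intro v w h
  exact Subtype.ext (ULift.down_injective (congrArg Subtype.val h))

/-- An element which is congruent to finitely many multiples of `x` modulo arbitrarily high `q k`
is a multiple of `x`. -/
theorem exists_eq_smul_of_frequently {M : Type w} [AddCommGroup M] [Module R M] [Module A M]
    [IsScalarTower R A M] (E : Finset A) (x : M) (z : Completion A s M)
    (h : ∀ K, ∃ k ≥ K, ∃ a ∈ E, z.1 k = Submodule.Quotient.mk (a • x)) :
    ∃ a : A, z = a • toCompletion A s M x := by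
  by_contra! hcon
  -- Each component determines the lower ones, so agreement at unboundedly many levels is agreement
  -- everywhere; each `a` therefore fails from some level on.
  have hex : ∀ a : A, ∃ k, ∀ l ≥ k, z.1 l ≠ Submodule.Quotient.mk (a • x) := by
    intro a
    by_contra! hall
    refine hcon a (Subtype.ext (funext fun k => ?_))
    obtain ⟨l, hl, hz⟩ := hall k
    exact Completion.component_of_le z hl hz
  choose d hd using hex
  classical
  obtain ⟨K, hK⟩ := (E.image d).exists_le
  obtain ⟨k, hk, a, ha, hz⟩ := h K
  exact hd a k ((hK _ (Finset.mem_image_of_mem _ ha)).trans hk) hz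

/-- The core of the argument, with denominators cleared and one common profile. -/
theorem exists_eq_smul_of_hasProfile [IsDomain R] [Module.Free R A] (hR : ¬ IsField R)
    (hs : Set.range s = {r : R | r ≠ 0}) {g : Set.Iio lam.ord → Base F A} {α : Set.Iio lam.ord}
    {N : ℕ} {Q : Finset A} {T : Set (ℕ → Bool)} (hT : T.Infinite) (hV : T ⊆ F.V α)
    (f : T → Base F A) (c : T → F.Branch →₀ A) (hp : ∀ v, HasProfile g α N Q (f v) (c v))
    (t : T → Hat F A s)
    (ht : ∀ v, t v = emb F A s (f v) + (c v).sum fun i a => a • rootElt s g i) (z : Hat F A s)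
    (hz : ∀ v w : T, v ≠ w →
      (∃ x, t v - t w + q s (br v w) • z = q s (br v w + 1) • x) ∨
      (∃ x, t v - t w - q s (br v w) • z = q s (br v w + 1) • x)) :
    ∃ a : A, z = a • emb F A s (g α) := by
  classical
  obtain ⟨M, hM⟩ := exists_q_detects_zero hR hs ((Q ×ˢ Q).image fun p => p.1 - p.2)
  have hQ : ∀ a ∈ Q, ∀ a' ∈ Q, (∃ y : A, a - a' = q s M • y) → a = a' := fun a ha a' ha' hy =>
    sub_eq_zero.1 (hM _ (Finset.mem_image.2 ⟨(a, a'), Finset.mk_mem_product ha ha', rfl⟩) hy)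
  obtain ⟨zM, hzM⟩ := Submodule.Quotient.mk_surjective _ (z.1 M)
  -- A representative of `z` modulo `q s M` has finite support, so from height `H` on the
  -- coordinates of `z` are divisible by `q s M`.
  obtain ⟨H, hH⟩ := (zM.support.image fun τ => τ.height + 1).exists_le
  refine exists_eq_smul_of_frequently ((Q ×ˢ Q).image fun p => p.1 - p.2) _ z fun K => ?_
  obtain ⟨v, hv, w, hw, hvw, hk⟩ := exists_le_br hT (max (max K N) (max M H))
  simp only [max_le_iff] at hk
  set k := br v w with hkdef
  refine ⟨k, hk.1.1, ?_⟩
  -- One of the two branches has value 1 at their branch point.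
  have hC : k ∈ F.C α := by
    have hne := apply_br_ne hvw
    rw [← hkdef] at hne
    cases hvk : v k with
    | true => exact Forest.mem_C_of_apply (hV hv) hvk
    | false =>
      refine Forest.mem_C_of_apply (hV hw) ?_
      cases hwk : w k with
      | true => rfl
      | false => exact absurd (hvk.trans hwk.symm) hne
  obtain ⟨ζ, hζ⟩ := Submodule.Quotient.mk_surjective _ (z.1 (k + 1))
  have hζk := Completion.component_of_le z (Nat.le_succ k) hζ.symm
  have hζM : ∀ τ : F.Node, τ.height = k → ∃ x : A, ζ τ = q s M • x := by
    intro τ hτ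
    have h1 := Completion.component_of_le z (by omega : M ≤ k + 1) hζ.symm
    obtain ⟨x, hx⟩ := (Submodule.Quotient.eq _).1 (h1.symm.trans hzM.symm)
    have h0 : zM τ = 0 := by
      by_contra h0
      have := hH _ (Finset.mem_image_of_mem _ (Finsupp.mem_support_iff.2 h0))
      omega
    refine ⟨x τ, ?_⟩
    have h2 := DFunLike.congr_fun hx τ
    rwa [Finsupp.sub_apply, h0, sub_zero] at h2
  have hcomp : ∀ v, (t v).1 (k + 1)
      = Submodule.Quotient.mk (f v + (c v).sum fun i a => a • head s g k i) := fun v => by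
    rw [ht v, normal_form_component]
  have key : ∀ ζ' : Base F A, ∀ x : Hat F A s,
      (t ⟨v, hv⟩).1 (k + 1) - (t ⟨w, hw⟩).1 (k + 1)
        + q s k • (Submodule.Quotient.mk ζ' : _ ⧸ qSub A s (Base F A) (k + 1))
        = q s (k + 1) • x.1 (k + 1) →
      (∀ τ : F.Node, τ.height = k → ∃ x : A, ζ' τ = q s M • x) →
      ∃ a ∈ Q, ∃ a' ∈ Q, ∃ x : Base F A, ζ' = (a' - a) • g α + q s k • x := by
    intro ζ' x hx hζ'
    rw [q_smul_quotient_eq_zero le_rfl, hcomp, hcomp, ← Submodule.Quotient.mk_sub,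
      ← Submodule.Quotient.mk_smul, ← Submodule.Quotient.mk_add,
      Submodule.Quotient.mk_eq_zero] at hx
    obtain ⟨y, hy⟩ := hx
    exact (hp ⟨v, hv⟩).exists_eq_smul_add hs (hp ⟨w, hw⟩) hk.1.2 hC hk.2.1 hQ hζ' hy
  have hmk : ∀ (a : A) (x : Base F A), ζ = a • g α + q s k • x →
      z.1 k = Submodule.Quotient.mk (a • g α) := by
    intro a x hx
    rw [hζk]
    refine (Submodule.Quotient.eq _).2 ⟨x, ?_⟩
    rw [hx]
    abel
  rcases hz ⟨v, hv⟩ ⟨w, hw⟩ (fun h => hvw (congrArg Subtype.val h)) with ⟨x, hx⟩ | ⟨x, hx⟩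
  · obtain ⟨a, ha, a', ha', y, hy⟩ := key ζ x
      (by rw [hζ]; exact congrFun (congrArg Subtype.val hx) (k + 1)) hζM
    exact ⟨a' - a, Finset.mem_image.2 ⟨(a', a), Finset.mk_mem_product ha' ha, rfl⟩, hmk _ y hy⟩
  -- The other sign amounts to replacing `ζ` by `-ζ`; the set of differences of elements of `Q` is
  -- symmetric.
  · obtain ⟨a, ha, a', ha', y, hy⟩ := key (-ζ) x
      (by
        rw [Submodule.Quotient.mk_neg, hζ, smul_neg, ← sub_eq_add_neg]
        exact congrFun (congrArg Subtype.val hx) (k + 1))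
      (fun τ hτ => by
        obtain ⟨x, hx⟩ := hζM τ hτ
        exact ⟨-x, by rw [Finsupp.neg_apply, hx, smul_neg]⟩)
    refine ⟨a - a', Finset.mem_image.2 ⟨(a, a'), Finset.mk_mem_product ha ha', rfl⟩,
      hmk _ (-y) ?_⟩
    rw [← neg_neg ζ, hy, neg_add, ← neg_smul, neg_sub, smul_neg]

/-- Multiples of an element with free quotient form a pure submodule of the completion. -/
theorem exists_eq_smul_of_q_smul_eq [IsDomain R] [Module.Free R A]
    (hs : Set.range s = {r : R | r ≠ 0}) {x : Base F A}
    (hx : x = 0 ∨ Module.Free A (Base F A ⧸ Submodule.span A {x})) {z : Hat F A s} {n : ℕ} {a : A}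
    (h : q s n • z = a • emb F A s x) : ∃ a' : A, z = a' • emb F A s x := by
  -- At level `n` the left side vanishes, so `a • x` is divisible by `q s n` already in the base
  -- module.
  have h1 : q s n • z.1 n = Submodule.Quotient.mk (a • x) :=
    congrFun (congrArg Subtype.val h) n
  rw [q_smul_quotient_eq_zero le_rfl, eq_comm, Submodule.Quotient.mk_eq_zero] at h1
  obtain ⟨y, hy⟩ := h1
  have hzy : z = emb F A s y := by
    refine sub_eq_zero.1 (Completion.eq_zero_of_q_smul_eq_zero hs (n := n) ?_)
    rw [smul_sub, h, ← toCompletion_q_smul, ← hy, map_smul, sub_self]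
  have hmem : y ∈ Submodule.span A {x} := by
    rcases hx with rfl | hx
    · rw [smul_zero] at hy
      rw [smul_right_injective (Base F A) (q_ne_zero hs n)
        (hy.symm.trans (smul_zero (q s n)).symm)]
      exact zero_mem _
    -- The quotient is free over `A`, hence over `R`, and so has no `R`-torsion.
    · have : Module.Free R (Base F A ⧸ Submodule.span A {x}) := Module.Free.trans (S := A)
      rw [← Submodule.Quotient.mk_eq_zero]
      refine smul_right_injective _ (q_ne_zero hs n) ?_
      change q s n • (Submodule.Quotient.mk y : Base F A ⧸ Submodule.span A {x}) = q s n • 0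
      rw [smul_zero, ← Submodule.Quotient.mk_smul, ← hy, Submodule.Quotient.mk_eq_zero]
      exact Submodule.smul_mem _ _ (Submodule.mem_span_singleton_self x)
  obtain ⟨a', rfl⟩ := Submodule.mem_span_singleton.1 hmem
  exact ⟨a', by rw [hzy, map_smul]⟩

end Family

end RigidTree
end

theorem mainTheorem2 {R : Type u} [CommRing R] [IsDomain R] [IsPrincipalIdealRing R]
    [Countable R] (hR : ¬ IsField R)
    {A : Type v} [Ring A] [Algebra R A] [Module.Free R A]
    (s : ℕ → R) (hs : Set.range s = {r : R | r ≠ 0})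
    (lam : Cardinal.{v}) (hA : #A < lam) (hlam : lam ≤ 2 ^ (ℵ₀ : Cardinal.{v}))
    (F : RigidTree.Forest (Order.succ #A + ℵ₁) lam)
    (b : Set.Iio lam.ord → RigidTree.Base F A) (hb : RigidTree.IsEnumeration F b)
    (α : Set.Iio lam.ord) (β : Ordinal.{v}) (hβ : β ≤ lam.ord) (m : ℕ)
    (T : Set (ℕ → Bool)) (hT : ∀ v ∈ T, ∀ w ∈ T, v ≠ w → m ≤ RigidTree.br v w)
    (t : T → RigidTree.Hat F A s) (z : RigidTree.Hat F A s)
    (hz : z ∈ RigidTree.G F s b) (hzm : ¬ ∃ x ∈ RigidTree.G F s b, z = RigidTree.q s m • x)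
    (ht : RigidTree.IsRigidFamily F s b α β T t z) :
    ∃ a : A, z = a • RigidTree.emb F A s (RigidTree.gElt F s b α) := by
  classical
  choose n f c hnf using fun v => RigidTree.exists_normal_form b (ht.mem v)
  choose N Q hp using fun v => RigidTree.exists_hasProfile (RigidTree.gElt F s b) α (f v) (c v)
  obtain ⟨⟨n₀, N₀, Q₀⟩, hinf⟩ :=
    RigidTree.exists_infinite_fiber_of_card ht.card fun v => (n v, N v, Q v)
  let T' : Set (ℕ → Bool) := Subtype.val '' ((fun v => (n v, N v, Q v)) ⁻¹' {(n₀, N₀, Q₀)})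
  have hT' : T'.Infinite := (Set.infinite_coe_iff.1 hinf).image Subtype.val_injective.injOn
  have hsub : ∀ v : T', v.1 ∈ T := by
    rintro ⟨_, v, _, rfl⟩
    exact v.2
  have htype : ∀ v : T', n ⟨v, hsub v⟩ = n₀ ∧ N ⟨v, hsub v⟩ = N₀ ∧ Q ⟨v, hsub v⟩ = Q₀ := by
    rintro ⟨_, v, hv, rfl⟩
    simpa using hv
  obtain ⟨a, ha⟩ := RigidTree.exists_eq_smul_of_hasProfile hR hs (N := N₀) (Q := Q₀) hT'
    (fun v hv => ht.subset (hsub ⟨v, hv⟩)) (fun v => f ⟨v, hsub v⟩) (fun v => c ⟨v, hsub v⟩)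
    (fun v => by
      have := hp ⟨v, hsub v⟩
      rwa [(htype v).2.1, (htype v).2.2] at this)
    -- Multiplying both the family and `z` by the common denominator preserves the rigidity
    -- congruences.
    (fun v => RigidTree.q s n₀ • t ⟨v, hsub v⟩)
    (fun v => by
      have := hnf ⟨v, hsub v⟩
      rwa [(htype v).1] at this)
    (RigidTree.q s n₀ • z)
    (fun v w hvw => by
      have hne : (⟨v, hsub v⟩ : T) ≠ ⟨w, hsub w⟩ := fun h =>
        hvw (Subtype.ext (Subtype.mk.inj h))
      refine (ht.rigid _ _ hne).imp ?_ ?_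
      · rintro ⟨x, _, hx⟩
        refine ⟨RigidTree.q s n₀ • x, ?_⟩
        rw [smul_comm _ _ x, ← hx, smul_add, smul_sub, smul_comm _ _ z]
      · rintro ⟨x, _, hx⟩
        refine ⟨RigidTree.q s n₀ • x, ?_⟩
        rw [smul_comm _ _ x, ← hx, smul_sub, smul_sub, smul_comm _ _ z])
  refine RigidTree.exists_eq_smul_of_q_smul_eq hs ?_ ha
  have hg : RigidTree.gElt F s b α = b α ∨ RigidTree.gElt F s b α = 0 := ite_eq_or_eq _ _ _
  rcases hg with hg | hg
  · rw [hg]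
    exact Or.inr (hb.1 α).2
  · exact Or.inl hg
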